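/- **Timed Petri nets.** A timed Petri net (TPN) $N=(P,T,\mathit{In},\mathit{Out})$ has a finite set $P$ of places, a finite set $T$ of transitions, and partial functions $\mathit{In},\mathit{Out}$ from $T\times P$ to intervals (open, closed or half open) with lower bound in $\mathbb N$ and upper bound in $\mathbb N\cup\{\infty\}$. Let $\max$ be the largest finite constant on its arcs ($0$ if there is none). A marking is a finite multiset over $P\times\mathbb R_{\ge 0}$ (tokens with a place and an age). A discrete transition $t$ removes, for each $p$ with $\mathit{In}(t,p)$ defined, one token on $p$ with age in $\mathit{In}(t,p)$, and adds, for each $p$ with $\mathit{Out}(t,p)$ defined, one token on $p$ with some age in $\mathit{Out}(t,p)$; a timed transition increases all ages by the same $x\ge 0$. An infinite computation $\pi$ is an infinite sequence of such transitions containing infinitely many discrete ones; its delay $\Delta(\pi)$ is the total time that passes. For real $m$ let $\mathit{ZENO}^m$ be the set of markings from which an infinite computation $\pi$ with $\Delta(\pi)\le m$ starts, and $\mathit{ZENO}=\bigcup_{m\ge 0}\mathit{ZENO}^m$. **The associated net $N'$.** Let $\mathit{Sym}$ consist of the symbols $k,\,k+$ ($0\le k\le\max$) and $k-$ ($1\le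 k\le\max$), ordered by $k<k+<(k+1)-<k+1$; for an interval $\mathcal I$ let $\mathit{enc}(\mathcal I)\subseteq \mathit{Sym}$ be the set of symbols lying between the bounds of $\mathcal I$ in this order. $N'$ is the net with places $p(\mathit{sym})$ ($p\in P$, $\mathit{sym}\in\mathit{Sym}$) and $p_{disc},p_{time1},p_{time2},p_{count},p_{dump}$, and with the following transitions, where a transition with input set $A$ and output set $B$ is enabled if every place in $A$ is marked, and firing it removes one token from each place of $A\setminus B$ and adds one to each place of $B\setminus A$: * for each $t\in T$, each choice of $s_p\in\mathit{enc}(\mathit{In}(t,p))$ for the input places $p$ of $t$ and of $s'_q\in\mathit{enc}(\mathit{Out}(t,q))$ for its output places $q$, a transition with input set $\{p(s_p)\}_p\cup\{p_{disc}\}$ and output set $\{q(s'_q)\}_q\cup\{p_{disc},p_{count}\}$; * one from $\{p_{disc},p_{count}\}$ to $\{p_{time1}\}$, and one from $\{p_{time2}\}$ to $\{p_{disc}\}$; * for $p\in P$ and $1\le k\le\max$, one from $\{p_{time2},p(k-)\}$ to $\{p_{time2},p(k)\}$ and one from $\{p_{time2},p(k-)\}$ to $\{p_{time2},p(k+)\}$;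 * one transfer transition, with input set $\{p_{time1}\}$ and output set $\{p_{time2}\}$, which in addition moves simultaneously, for all $p\in P$ and $0\le k\le\max$, all tokens from $p(k)$ to $p(k+)$, and all tokens from $p_{count}$ to $p_{dump}$. A marking $M'$ of $N'$ (a map from its places to $\mathbb N$) is standard if $M'(p_{disc})=1$ and $M'(p_{time1})=M'(p_{time2})=M'(p_{count})=0$. $\mathit{INF}'$ is the set of standard markings of $N'$ from which an infinite computation of $N'$ starts. **Regions.** A region is a triple $(b_0,w,b_{\max})$ with $b_0$ a finite multiset over $P\times\{0,\dots,\max\}$, $w=b_1\bullet\dots\bullet b_n$ a word of nonempty finite multisets over $P\times\{0,\dots,\max-1\}$, and $b_{\max}$ a finite multiset over $P$. It denotes the set of markings $M$ of $N$ for which there are $0<f_1<\dots<f_n<1$ such that $M$ consists of a token on $p$ of age $k$ for each $(p,k)$ in $b_0$, a token on $p$ of age $k+f_i$ for each $(p,k)$ in $b_i$ ($1\le i\le n$), and a token on $p$ of some age $>\max$ for each $p$ in $b_{\max}$ (all with multiplicity). Its upward closure $[\![R]\!]\!\uparrow$ is the set of markings that contain, as multisets, a marking denoted by $R$. For a standard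 marking $M'$, $\mathit{perm}(M'^-)$ is the set of words $b_1\bullet\dots\bullet b_n$ of nonempty finite multisets over $P\times\{0,\dots,\max-1\}$ with $\sum_i b_i((p,k))=M'(p((k+1)-))$ for all $p$ and $k<\max$; $\mathit{perm}(M'^+)$ is defined in the same way with $M'(p(k+))$ in place of $M'(p((k+1)-))$. For $w_+\in\mathit{perm}(M'^+)$, $w_-\in\mathit{perm}(M'^-)$ let $\mathit{Reg}(M',w_+,w_-)=(b_0,\,w_+\bullet w_-,\,b_{\max})$ with $b_0((p,k))=M'(p(k))$ and $b_{\max}(p)=M'(p(\max+))$. **Lemma.** Let $N$ be a TPN with associated net $N'$ and let $M'\in\mathit{INF}'$. Then $$\exists w_-\in\mathit{perm}(M'^-).\ \forall w_+\in\mathit{perm}(M'^+).\quad [\![\mathit{Reg}(M',w_+,w_-)]\!]\!\uparrow\ \subseteq\ \bigcup_{\delta>0}\mathit{ZENO}^{1-\delta}\ \subseteq\ \mathit{ZENO}.$$ -/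

import Mathlib

open scoped NNReal ENNReal

/-! ### Timed Petri nets -/

/-- Intervals with a natural number `w` as lower bound and `z ∈ ℕ ∪ {∞}` as upper bound:
`[w:z]`, `(w:z]`, `[w:z)`, `(w:z)`. -/
inductive Intrv : Type
  | cc (w : ℕ) (z : ℕ∞)
  | oc (w : ℕ) (z : ℕ∞)
  | co (w : ℕ) (z : ℕ∞)
  | oo (w : ℕ) (z : ℕ∞)

/-- The set of ages (nonnegative reals) lying in an interval. -/
def Intrv.ages : Intrv → Set ℝ≥0
  | .cc w z => {x | (w : ℝ≥0∞) ≤ x ∧ (x : ℝ≥0∞) ≤ (z : ℝ≥0∞)}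
  | .oc w z => {x | (w : ℝ≥0∞) < x ∧ (x : ℝ≥0∞) ≤ (z : ℝ≥0∞)}
  | .co w z => {x | (w : ℝ≥0∞) ≤ x ∧ (x : ℝ≥0∞) < (z : ℝ≥0∞)}
  | .oo w z => {x | (w : ℝ≥0∞) < x ∧ (x : ℝ≥0∞) < (z : ℝ≥0∞)}

/-- The largest finite constant occurring in an interval (`ENat.toNat ⊤ = 0`, so an infinite
upper bound does not count). -/
def Intrv.maxConst : Intrv → ℕ
  | .cc w z => max w z.toNat
  | .oc w z => max w z.toNat
  | .co w z => max w z.toNat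
  | .oo w z => max w z.toNat

/-- A timed Petri net with places `P` and transitions `T`: two partial functions giving the
intervals on the input arcs and on the output arcs. -/
structure TPN (P T : Type*) where
  In : T → P → Option Intrv
  Out : T → P → Option Intrv

namespace TPN

/-- A marking: a finite multiset of tokens, each with a place and an age. -/
abbrev Marking (P : Type*) := Multiset (P × ℝ≥0)

/-- The maximal finite constant on the arcs of the net (`0` if there are no arcs). -/
def maxConst {P T : Type*} [Fintype P] [Fintype T] (N : TPN P T) : ℕ :=
  Finset.univ.sup fun tp : T × P =>
    max ((N.In tp.1 tp.2).elim 0 Intrv.maxConst) ((N.Out tp.1 tp.2).elim 0 Intrv.maxConst)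

/-- `b` consists of exactly one token for every arc `p(I)` in `a`, lying on `p` with an age
in `I`. -/
def IsTokensFor {P : Type*} [Fintype P] (a : P → Option Intrv) (b : Marking P) : Prop :=
  ∃ x : P → ℝ≥0, (∀ p I, a p = some I → x p ∈ I.ages) ∧
    b = (Finset.univ.filter fun p => (a p).isSome).val.map fun p => (p, x p)

/-- Firing the discrete transition `t`: remove one token of suitable age per input arc, add one
token of suitable age per output arc. -/
def DiscStep {P T : Type*} [Fintype P] (N : TPN P T) (t : T) (M₁ M₂ : Marking P) : Prop :=
  ∃ b₁ b₂ c : Marking P, IsTokensFor (N.In t) b₁ ∧ IsTokensFor (N.Out t) b₂ ∧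
    M₁ = b₁ + c ∧ M₂ = c + b₂

/-- All tokens age by `x`. -/
noncomputable def age {P : Type*} (M : Marking P) (x : ℝ≥0) : Marking P :=
  M.map fun q => (q.1, q.2 + x)

/-- The transitions of the semantics: `disc t` fires `t`, `time x` lets time `x` pass. -/
inductive Action (T : Type*)
  | disc (t : T)
  | time (x : ℝ≥0)

/-- The amount of time an action takes. -/
def Action.delay {T : Type*} : Action T → ℝ≥0
  | .disc _ => 0
  | .time x => x

/-- The labelled transition relation of the net. -/
def Step {P T : Type*} [Fintype P] (N : TPN P T) (M₁ : Marking P) :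
    Action T → Marking P → Prop
  | .disc t, M₂ => N.DiscStep t M₁ M₂
  | .time x, M₂ => M₂ = age M₁ x

/-- An infinite computation. Consecutive timed transitions count as one passage of time, so
infinitely many discrete transitions must occur. -/
structure InfComputation {P T : Type*} [Fintype P] (N : TPN P T) where
  marking : ℕ → Marking P
  action : ℕ → Action T
  step : ∀ i, N.Step (marking i) (action i) (marking (i + 1))
  infinitely_often_disc : ∀ i, ∃ j, i ≤ j ∧ ∃ t, action j = .disc t

/-- The delay `Δ(π)`: the total amount of time that passes. -/
noncomputable def InfComputation.delay {P T : Type*} [Fintype P] {N : TPN P T}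
    (π : InfComputation N) : ℝ≥0∞ :=
  ∑' i, ((π.action i).delay : ℝ≥0∞)

/-- `ZENO^m`: markings with an infinite computation of delay at most `m`. -/
def zenoWithin {P T : Type*} [Fintype P] (N : TPN P T) (m : ℝ) : Set (Marking P) :=
  {M | ∃ π : InfComputation N, π.marking 0 = M ∧ (π.delay : EReal) ≤ (m : EReal)}

/-- `ZENO`: the zeno-markings. -/
def zeno {P T : Type*} [Fintype P] (N : TPN P T) : Set (Marking P) :=
  ⋃ m : {m : ℝ // 0 ≤ m}, N.zenoWithin m

end TPN

/-! ### Simultaneous-disjoint-transfer nets -/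

/-- A simultaneous-disjoint-transfer net with places `P` and ordinary transitions `T`. The
transfer transition is `(I, O, ST)`. -/
structure SDTN (P T : Type*) where
  input : T → Set P
  output : T → Set P
  I : Set P
  O : Set P
  ST : Set (P × P)
  source_ne_target : ∀ a ∈ ST, ∀ b ∈ ST, a.1 ≠ b.2
  source_inj : ∀ a ∈ ST, ∀ b ∈ ST, a.1 = b.1 → a = b
  target_inj : ∀ a ∈ ST, ∀ b ∈ ST, a.2 = b.2 → a = b
  disjoint_IO : ∀ a ∈ ST, a.1 ∉ I ∪ O ∧ a.2 ∉ I ∪ O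

namespace SDTN

/-- Firing an ordinary transition. -/
def Fires {P T : Type*} (N : SDTN P T) (t : T) (M M' : P → ℕ) : Prop :=
  (∀ p ∈ N.input t, 1 ≤ M p) ∧
  ∀ p, (p ∈ N.input t → p ∈ N.output t → M' p = M p) ∧
    (p ∈ N.input t → p ∉ N.output t → M' p = M p - 1) ∧
    (p ∉ N.input t → p ∈ N.output t → M' p = M p + 1) ∧
    (p ∉ N.input t → p ∉ N.output t → M' p = M p)

/-- Firing the transfer transition. -/
def FiresTrans {P T : Type*} (N : SDTN P T) (M M' : P → ℕ) : Prop :=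
  (∀ p ∈ N.I, 1 ≤ M p) ∧
  ∀ p, (p ∈ N.I → p ∈ N.O → M' p = M p) ∧
    (p ∈ N.I → p ∉ N.O → M' p = M p - 1) ∧
    (p ∉ N.I → p ∈ N.O → M' p = M p + 1) ∧
    (∀ p', (p, p') ∈ N.ST → M' p = 0) ∧
    (∀ p', (p', p) ∈ N.ST → M' p = M p + M p') ∧
    (p ∉ N.I → p ∉ N.O → (∀ p', (p, p') ∉ N.ST) → (∀ p', (p', p) ∉ N.ST) → M' p = M p)

/-- One step: an ordinary transition or the transfer transition. -/
def Step {P T : Type*} (N : SDTN P T) (M M' : P → ℕ) : Prop :=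
  (∃ t, N.Fires t M M') ∨ N.FiresTrans M M'

/-- `INF`: the markings from which an infinite computation starts. -/
def inf {P T : Type*} (N : SDTN P T) : Set (P → ℕ) :=
  {M | ∃ μ : ℕ → P → ℕ, μ 0 = M ∧ ∀ i, N.Step (μ i) (μ (i + 1))}

end SDTN

/-! ### From a timed Petri net to a simultaneous-disjoint-transfer net -/

/-- The symbols `k` and `k+` for `0 ≤ k ≤ m`, and `k-` for `1 ≤ k ≤ m`. Here `minus k` with
`0 ≤ k < m` stands for `(k+1)-`. -/
inductive AgeSym (m : ℕ) : Type
  | exact (k : Fin (m + 1))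
  | plus (k : Fin (m + 1))
  | minus (k : Fin m)

/-- The rank in the total order `k < k+ < (k+1)- < k+1`; the symbol `k` has rank `3 * k`. -/
def AgeSym.rank {m : ℕ} : AgeSym m → ℕ
  | .exact k => 3 * k
  | .plus k => 3 * k + 1
  | .minus k => 3 * k + 2

/-- The encoding of an interval: the symbols that lie between its bounds. -/
def Intrv.enc (m : ℕ) : Intrv → Set (AgeSym m)
  | .cc w z => {s | 3 * w ≤ s.rank ∧ (s.rank : ℕ∞) ≤ 3 * z}
  | .oc w z => {s | 3 * w < s.rank ∧ (s.rank : ℕ∞) ≤ 3 * z}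
  | .co w z => {s | 3 * w ≤ s.rank ∧ (s.rank : ℕ∞) < 3 * z}
  | .oo w z => {s | 3 * w < s.rank ∧ (s.rank : ℕ∞) < 3 * z}

/-- The places of the constructed net: `p(sym)`, the control places, the counter and the dump. -/
inductive SPlace (P : Type*) (m : ℕ)
  | tok (p : P) (s : AgeSym m)
  | disc
  | time1
  | time2
  | count
  | dump

/-- All sets `{p₁(sym₁), …, pₙ(symₙ)}` with `symᵢ ∈ enc(Iᵢ)`, where `p₁(I₁), …, pₙ(Iₙ)` are the
arcs in `a`. -/
def encArcs {P : Type*} (m : ℕ) (a : P → Option Intrv) : Set (Set (SPlace P m)) :=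
  {A | ∃ s : P → AgeSym m, (∀ p I, a p = some I → s p ∈ I.enc m) ∧
    A = {q | ∃ p, (a p).isSome ∧ q = .tok p (s p)}}

/-- The ordinary transitions of the constructed net. -/
inductive STrans {P T : Type*} (N : TPN P T) (m : ℕ)
  /-- `t'(A, B)`, simulating the transition `t` -/
  | disc (t : T) (A B : Set (SPlace P m))
      (hA : A ∈ encArcs m (N.In t)) (hB : B ∈ encArcs m (N.Out t))
  | switchTime
  /-- a token of age `(k+1)-` on `p` reaches age `k+1` -/
  | reach (p : P) (k : Fin m)
  /-- a token of age `(k+1)-` on `p` exceeds age `k+1` -/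
  | exceed (p : P) (k : Fin m)
  | switchDisc

namespace TPN

variable {P T : Type*}

/-- Input places of the ordinary transitions of the constructed net. -/
def sInput (N : TPN P T) (m : ℕ) : STrans N m → Set (SPlace P m)
  | .disc _ A _ _ _ => A ∪ {.disc}
  | .switchTime => {.disc, .count}
  | .reach p k => {.time2, .tok p (.minus k)}
  | .exceed p k => {.time2, .tok p (.minus k)}
  | .switchDisc => {.time2}

/-- Output places of the ordinary transitions of the constructed net. -/
def sOutput (N : TPN P T) (m : ℕ) : STrans N m → Set (SPlace P m)
  | .disc _ _ B _ _ => B ∪ {.disc, .count}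
  | .switchTime => {.time1}
  | .reach p k => {.time2, .tok p (.exact k.succ)}
  | .exceed p k => {.time2, .tok p (.plus k.succ)}
  | .switchDisc => {.disc}

/-- The simultaneous-disjoint-transfer net corresponding to a timed Petri net. -/
def toSDTN [Fintype P] [Fintype T] (N : TPN P T) :
    SDTN (SPlace P N.maxConst) (STrans N N.maxConst) where
  input := N.sInput N.maxConst
  output := N.sOutput N.maxConst
  I := {.time1}
  O := {.time2}
  ST := {e | ∃ p k, e = (.tok p (.exact k), .tok p (.plus k))} ∪ {(.count, .dump)}
  source_ne_target := by
    rintro a (⟨p, k, rfl⟩ | rfl) b (⟨q, l, rfl⟩ | rfl) <;> simp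
  source_inj := by
    rintro a (⟨p, k, rfl⟩ | rfl) b (⟨q, l, rfl⟩ | rfl) <;> simp
  target_inj := by
    rintro a (⟨p, k, rfl⟩ | rfl) b (⟨q, l, rfl⟩ | rfl) <;> simp
  disjoint_IO := by
    rintro a (⟨p, k, rfl⟩ | rfl) <;> simp

end TPN

/-- Standard markings. -/
def IsStandard {P : Type*} {m : ℕ} (M' : SPlace P m → ℕ) : Prop :=
  M' .disc = 1 ∧ M' .time1 = 0 ∧ M' .time2 = 0 ∧ M' .count = 0

/-- `INF'`: the standard markings in `INF`. -/
def TPN.infStd {P T : Type*} [Fintype P] [Fintype T] (N : TPN P T) :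
    Set (SPlace P N.maxConst → ℕ) :=
  {M' | M' ∈ N.toSDTN.inf ∧ IsStandard M'}

/-! ### Permutations and regions -/

/-- The sub-marking `M'⁻`: only the tokens on places `p(k-)`. -/
def minusPart {P : Type*} {m : ℕ} (M' : SPlace P m → ℕ) : SPlace P m → ℕ
  | .tok p (.minus k) => M' (.tok p (.minus k))
  | _ => 0

/-- The sub-marking `M'⁺`: only the tokens on places `p(k+)`. -/
def plusPart {P : Type*} {m : ℕ} (M' : SPlace P m → ℕ) : SPlace P m → ℕ
  | .tok p (.plus k) => M' (.tok p (.plus k))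
  | _ => 0

open Classical in
/-- `perm(M'⁻)`, for a marking `X = M'⁻`: words of nonempty multisets over `P × {0,…,m-1}` in which
`(p,k)` occurs as often as `X` has tokens on `p((k+1)-)`. -/
def permMinus {P : Type*} {m : ℕ} (X : SPlace P m → ℕ) : Set (List (Multiset (P × Fin m))) :=
  {w | (∀ b ∈ w, b ≠ 0) ∧
    ∀ p (k : Fin m), X (.tok p (.minus k)) = (w.map fun b => b.count (p, k)).sum}

open Classical in
/-- `perm(M'⁺)`, for a marking `X = M'⁺`: words of nonempty multisets over `P × {0,…,m-1}` in which
`(p,k)` occurs as often as `X` has tokens on `p(k+)`. -/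
def permPlus {P : Type*} {m : ℕ} (X : SPlace P m → ℕ) : Set (List (Multiset (P × Fin m))) :=
  {w | (∀ b ∈ w, b ≠ 0) ∧
    ∀ p (k : Fin m), X (.tok p (.plus k.castSucc)) = (w.map fun b => b.count (p, k)).sum}

/-- A region `(b₀, w, b_max)`. -/
structure Region (P : Type*) (m : ℕ) where
  b0 : Multiset (P × Fin (m + 1))
  w : List (Multiset (P × Fin m))
  w_ne : ∀ b ∈ w, b ≠ 0
  bmax : Multiset P

namespace Region

/-- The markings characterized by a region: `b₀` lists the tokens whose age is an integer `≤ m`; the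
`i`-th letter of `w` lists the tokens of age `< m` with fractional part `f i > 0` (together with the
integer parts of their ages), where `f` is strictly increasing; `b_max` lists the places of the
tokens of age `> m`. -/
def markings {P : Type*} {m : ℕ} (R : Region P m) : Set (TPN.Marking P) :=
  {M | ∃ (f : Fin R.w.length → ℝ≥0) (B : TPN.Marking P),
    StrictMono f ∧ (∀ i, 0 < f i ∧ f i < 1) ∧
    (∀ q ∈ B, (m : ℝ≥0) < q.2) ∧ B.map Prod.fst = R.bmax ∧
    M = R.b0.map (fun q => (q.1, ((q.2 : ℕ) : ℝ≥0))) +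
      ∑ i, (R.w.get i).map (fun q => (q.1, ((q.2 : ℕ) : ℝ≥0) + f i)) + B}

/-- The upward closure of the set of markings characterized by a region. -/
def upMarkings {P : Type*} {m : ℕ} (R : Region P m) : Set (TPN.Marking P) :=
  {M | ∃ M₀ ∈ R.markings, M₀ ≤ M}

end Region

/-- The region `Reg(M', w₊, w₋) = (b₀, w₊ • w₋, b_max)` with `b₀((p,k)) = M'(p(k))` and
`b_max(p) = M'(p(max+))`. -/
def reg {P : Type*} [Fintype P] {m : ℕ} (M' : SPlace P m → ℕ)
    (wp wm : List (Multiset (P × Fin m)))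
    (hp : wp ∈ permPlus (plusPart M')) (hm : wm ∈ permMinus (minusPart M')) : Region P m where
  b0 := ∑ q : P × Fin (m + 1), Multiset.replicate (M' (.tok q.1 (.exact q.2))) q
  w := wp ++ wm
  w_ne := fun b hb => (List.mem_append.mp hb).elim (hp.1 b) (hm.1 b)
  bmax := ∑ p : P, Multiset.replicate (M' (.tok p (.plus (Fin.last m)))) p

/-! Fix an infinite computation of the constructed net from `M'`. It dictates when each token on a
place p(k-) must reach an integer age. Treat each such place as a first-in-first-out queue and give
its n-th consumed token a key: 2j+1 if it becomes an exact integer after the j-th transfer, 2j if it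
is moved past that integer then, `⊤` if a discrete transition consumes it or it stays forever. A
smaller key means an earlier crossing, hence a larger fractional part. So the word w₋ lists the
initial tokens, grouped by key, in decreasing order of keys. It depends on the computation only, not
on w₊.

In a marking of the region, the fractional parts along w₋ form a strictly antitone function on
finitely many keys, with values above all those along w₊ and below 1. Since ℕ∞ is countable and the
reals are dense, it extends to a strictly antitone `F` on all keys (`exists_strictAnti_extension`).
Let time 1 - F(2j+1) have passed after the j-th transfer. Then a token with initial fractional part
F(κ) is exactly at an integer in phase j if κ = 2j+1, and is beyond it in phase j, but not before,
if κ = 2j. Tokens produced later are given the age that their key requires. The elapsed time stays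
below 1 - F(⊤), and tokens at k+ with k < max have fractional part below F(⊤) plus the elapsed time,
so they never reach the next integer.

Hence the timed net imitates every step, carrying surplus tokens along (`Simulates.step`), with
total delay at most 1 - F(⊤); this gives δ = F(⊤). The imitation is an infinite computation because
the counter place forces infinitely many discrete transitions (`infinitely_often_disc`). -/

/-! ### Extending strictly antitone functions -/

/-- A strictly monotone function on a finite subset of a countable linear order, with values in a
dense linear order without endpoints, extends to the whole order. -/
theorem exists_strictMono_extension {α β : Type*} [LinearOrder α] [Countable α] [LinearOrder β]
    [DenselyOrdered β] [NoMinOrder β] [NoMaxOrder β] [Nonempty β] (K : Finset α) (f : α → β)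
    (hf : StrictMonoOn f K) : ∃ g : α → β, StrictMono g ∧ ∀ a ∈ K, g a = f a := by
  classical
  cases nonempty_encodable α
  -- The graph of `f` on `K` is a finite partial isomorphism. The usual "forth" construction is run
  -- from it instead of from the empty one, so the limit agrees with `f` on `K`.
  let start : Order.PartialIso α β := ⟨K.image fun a => (a, f a), by
    intro p hp q hq
    obtain ⟨a, ha, rfl⟩ := Finset.mem_image.1 hp
    obtain ⟨b, hb, rfl⟩ := Finset.mem_image.1 hq
    exact (hf.cmp_map_eq ha hb).symm⟩
  let I : Order.Ideal (Order.PartialIso α β) :=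
    Order.idealOfCofinals start (Order.PartialIso.definedAtLeft β)
  have hI : start ∈ I := Order.mem_idealOfCofinals start (Order.PartialIso.definedAtLeft β)
  let F a := Order.PartialIso.funOfIdeal a I (Order.cofinal_meets_idealOfCofinals _ _ a)
  refine ⟨fun a => (F a).val, fun a₁ a₂ => ?_, fun a ha => ?_⟩
  · rcases (F a₁).prop with ⟨f, hf, ha₁⟩
    rcases (F a₂).prop with ⟨g, hg, ha₂⟩
    rcases I.directed _ hf _ hg with ⟨m, _, fm, gm⟩
    exact (lt_iff_lt_of_cmp_eq_cmp <| m.prop (a₁, _) (fm ha₁) (a₂, _) (gm ha₂)).mp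
  · rcases (F a).prop with ⟨g, hg, ha₂⟩
    rcases I.directed _ hI _ hg with ⟨m, _, fm, gm⟩
    have h1 : (a, f a) ∈ m.val := fm (Finset.mem_image_of_mem _ ha)
    have := m.prop _ h1 _ (gm ha₂)
    rw [cmp_self_eq_eq] at this
    exact ((cmp_eq_eq_iff _ _).1 this.symm).symm

/-- Apply the previous extension with the order dual of the open interval (a, 1) as target: it is
dense and has no endpoints. -/
theorem exists_strictAnti_extension {a : ℝ≥0} (ha : a < 1) (K : Finset ℕ∞) (f : ℕ∞ → ℝ≥0)
    (hf : StrictAntiOn f K) (hfm : ∀ κ ∈ K, a < f κ ∧ f κ < 1) :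
    ∃ F : ℕ∞ → ℝ≥0, StrictAnti F ∧ (∀ κ, a < F κ ∧ F κ < 1) ∧ ∀ κ ∈ K, F κ = f κ := by
  classical
  obtain ⟨b, hb⟩ := exists_between ha
  have : Nonempty (Set.Ioo a 1) := ⟨⟨b, hb⟩⟩
  -- The value `b` is a dummy, never attained through the `else` branch on `K`.
  let f' : ℕ∞ → (Set.Ioo a 1)ᵒᵈ := fun κ =>
    OrderDual.toDual (if h : a < f κ ∧ f κ < 1 then ⟨f κ, h⟩ else ⟨b, hb⟩)
  have hf' : ∀ κ ∈ K, ((OrderDual.ofDual (f' κ) : Set.Ioo a 1) : ℝ≥0) = f κ := by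
    intro κ hκ
    simp [f', hfm κ hκ]
  obtain ⟨g, hg, hgf⟩ := exists_strictMono_extension K f' (by
    intro x hx y hy hxy
    change (OrderDual.ofDual (f' y) : Set.Ioo a 1).1 < (OrderDual.ofDual (f' x) : Set.Ioo a 1).1
    rw [hf' x hx, hf' y hy]
    exact hf hx hy hxy)
  refine ⟨fun κ => (OrderDual.ofDual (g κ)).1, fun x y hxy => hg hxy,
    fun κ => (OrderDual.ofDual (g κ)).2, fun κ hκ => ?_⟩
  simp only [hgf κ hκ, hf' κ hκ]

/-! ### Symbols and ages -/

/-- The ages a symbol stands for. -/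
def AgeSym.Denotes {m : ℕ} : AgeSym m → ℝ≥0 → Prop
  | .exact k, x => x = (k : ℕ)
  | .plus k, x => ((k : ℕ) : ℝ≥0) < x ∧ ((k : ℕ) < m → x < (k : ℕ) + 1)
  | .minus k, x => ((k : ℕ) : ℝ≥0) < x ∧ x < (k : ℕ) + 1

theorem AgeSym.Denotes.lower {m : ℕ} {s : AgeSym m} {x : ℝ≥0} (h : s.Denotes x) {w : ℕ} :
    (3 * w ≤ s.rank → (w : ℝ≥0) ≤ x) ∧ (3 * w < s.rank → (w : ℝ≥0) < x) := by
  have key : ∀ k : ℕ, w ≤ k → (k : ℝ≥0) < x → (w : ℝ≥0) < x := fun k h1 h2 =>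
    lt_of_le_of_lt (by exact_mod_cast h1) h2
  cases s with
  | exact k =>
    simp only [Denotes] at h
    subst h
    simp only [rank]
    exact ⟨fun h => by exact_mod_cast (by omega : w ≤ k),
      fun h => by exact_mod_cast (by omega : w < k)⟩
  | plus k =>
    simp only [rank]
    exact ⟨fun h' => (key k (by omega) h.1).le, fun h' => key k (by omega) h.1⟩
  | minus k =>
    simp only [rank]
    exact ⟨fun h' => (key k (by omega) h.1).le, fun h' => key k (by omega) h.1⟩

/-- The bound `z ≤ m` matters because the symbol m+ stands for arbitrarily large ages; the rank
condition then excludes it. -/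
theorem AgeSym.Denotes.upper {m : ℕ} {s : AgeSym m} {x : ℝ≥0} (h : s.Denotes x) {z : ℕ}
    (hz : z ≤ m) :
    (s.rank ≤ 3 * z → x ≤ z) ∧ (s.rank < 3 * z → x < z) := by
  have key : ∀ k : ℕ, k + 1 ≤ z → x < (k : ℝ≥0) + 1 → x < z := fun k h1 h2 =>
    lt_of_lt_of_le h2 (by exact_mod_cast h1)
  cases s with
  | exact k =>
    simp only [Denotes] at h
    subst h
    simp only [rank]
    exact ⟨fun h => by exact_mod_cast (by omega : (k : ℕ) ≤ z),
      fun h => by exact_mod_cast (by omega : (k : ℕ) < z)⟩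
  | plus k =>
    simp only [rank]
    exact ⟨fun h' => (key k (by omega) (h.2 (by omega))).le,
      fun h' => key k (by omega) (h.2 (by omega))⟩
  | minus k =>
    simp only [rank]
    exact ⟨fun h' => (key k (by omega) h.2).le, fun h' => key k (by omega) h.2⟩

theorem AgeSym.Denotes.mem_ages {m : ℕ} {s : AgeSym m} {x : ℝ≥0} (h : s.Denotes x) {I : Intrv}
    (hs : s ∈ I.enc m) (hI : I.maxConst ≤ m) : x ∈ I.ages := by
  have h3 : ∀ z : ℕ, (3 : ℕ∞) * z = ((3 * z : ℕ) : ℕ∞) := fun z => by push_cast; rfl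
  have hw : ∀ w : ℕ, ((w : ℝ≥0∞) ≤ x ↔ (w : ℝ≥0) ≤ x) ∧ ((w : ℝ≥0∞) < x ↔ (w : ℝ≥0) < x) ∧
      ((x : ℝ≥0∞) ≤ w ↔ x ≤ w) ∧ ((x : ℝ≥0∞) < w ↔ x < w) := fun w => by
    norm_cast
  cases I with
  | _ w z =>
    have hl := h.lower (w := w)
    induction z using ENat.recTopCoe with
    | top =>
      simp only [Intrv.enc, Set.mem_ofPred_eq] at hs
      simp [Intrv.ages, hw, hl.1, hl.2, hs.1]
    | coe z =>
      have hu := h.upper (z := z) (by simp [Intrv.maxConst] at hI; exact hI.2)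
      simp only [Intrv.enc, Set.mem_ofPred_eq, h3, Nat.cast_le, Nat.cast_lt] at hs
      simp [Intrv.ages, hw, hl.1, hl.2, hu.1, hu.2, hs.1, hs.2]

/-- The three kinds of symbols. -/
def AgeSym.equivSum (m : ℕ) : (Fin (m + 1) ⊕ Fin (m + 1)) ⊕ Fin m ≃ AgeSym m where
  toFun := Sum.elim (Sum.elim .exact .plus) .minus
  invFun
    | .exact k => .inl (.inl k)
    | .plus k => .inl (.inr k)
    | .minus k => .inr k
  left_inv := by rintro ((k | k) | k) <;> rfl
  right_inv := by rintro (k | k | k) <;> rfl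

instance (m : ℕ) : Fintype (AgeSym m) := Fintype.ofEquiv _ (AgeSym.equivSum m)

theorem AgeSym.sum_eq {m : ℕ} {A : Type*} [AddCommMonoid A] (g : AgeSym m → A) :
    ∑ s, g s = ∑ k, g (.exact k) + ∑ k, g (.plus k) + ∑ k, g (.minus k) := by
  rw [← (AgeSym.equivSum m).sum_comp g]
  simp [AgeSym.equivSum, Fintype.sum_sum_type]

namespace TPN

theorem In_maxConst_le {P T : Type*} [Fintype P] [Fintype T] (N : TPN P T) {t : T} {p : P}
    {I : Intrv} (h : N.In t p = some I) : I.maxConst ≤ N.maxConst := by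
  refine le_trans ?_ (Finset.le_sup (f := fun tp : T × P =>
    max ((N.In tp.1 tp.2).elim 0 Intrv.maxConst) ((N.Out tp.1 tp.2).elim 0 Intrv.maxConst))
    (Finset.mem_univ (t, p)))
  simp [h]

theorem Out_maxConst_le {P T : Type*} [Fintype P] [Fintype T] (N : TPN P T) {t : T} {p : P}
    {I : Intrv} (h : N.Out t p = some I) : I.maxConst ≤ N.maxConst := by
  refine le_trans ?_ (Finset.le_sup (f := fun tp : T × P =>
    max ((N.In tp.1 tp.2).elim 0 Intrv.maxConst) ((N.Out tp.1 tp.2).elim 0 Intrv.maxConst))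
    (Finset.mem_univ (t, p)))
  simp [h]

end TPN

-- The four cases of the firing rule as one equation without truncated subtraction, suited to
-- `omega` and to summation over places.
open Classical in
theorem SDTN.Fires.balance {P T : Type*} {N : SDTN P T} {t : T} {M M' : P → ℕ}
    (h : N.Fires t M M') (p : P) :
    M' p + (if p ∈ N.input t then 1 else 0) = M p + if p ∈ N.output t then 1 else 0 := by
  have h1 := h.1 p
  obtain ⟨a, b, c, d⟩ := h.2 p
  by_cases hi : p ∈ N.input t <;> by_cases ho : p ∈ N.output t <;> simp_all

/-! ### Infinite computations of the constructed net -/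

/-- An infinite computation of the net `N'` from a standard marking; `act i = none` says that the
`i`-th step is the transfer transition. -/
structure StdRun {P T : Type*} [Fintype P] [Fintype T] (N : TPN P T) where
  μ : ℕ → SPlace P N.maxConst → ℕ
  act : ℕ → Option (STrans N N.maxConst)
  fires : ∀ i t, act i = some t → N.toSDTN.Fires t (μ i) (μ (i + 1))
  trans : ∀ i, act i = none → N.toSDTN.FiresTrans (μ i) (μ (i + 1))
  std : IsStandard (μ 0)

theorem TPN.exists_stdRun {P T : Type*} [Fintype P] [Fintype T] {N : TPN P T}
    {M' : SPlace P N.maxConst → ℕ} (h : M' ∈ N.infStd) : ∃ r : StdRun N, r.μ 0 = M' := by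
  obtain ⟨⟨μ, h0, hμ⟩, hs⟩ := h
  have : ∀ i, ∃ a : Option (STrans N N.maxConst),
      (∀ t, a = some t → N.toSDTN.Fires t (μ i) (μ (i + 1))) ∧
      (a = none → N.toSDTN.FiresTrans (μ i) (μ (i + 1))) := by
    intro i
    rcases hμ i with ⟨t, ht⟩ | ht
    · exact ⟨some t, by rintro _ ⟨⟩; exact ht, by simp⟩
    · exact ⟨none, by simp, fun _ => ht⟩
  choose a ha hb using this
  exact ⟨⟨μ, a, ha, hb, h0 ▸ hs⟩, h0⟩

theorem control_notMem_of_mem_encArcs {P : Type*} {m : ℕ} {a : P → Option Intrv}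
    {A : Set (SPlace P m)} (hA : A ∈ encArcs m a) : .disc ∉ A ∧ .time1 ∉ A ∧ .time2 ∉ A := by
  obtain ⟨s, -, rfl⟩ := hA
  simp

namespace StdRun

variable {P T : Type*} [Fintype P] [Fintype T] {N : TPN P T} (r : StdRun N)

/-- The number of transfer steps before step `i`. -/
def phase (i : ℕ) : ℕ := Nat.count (fun j => (r.act j).isNone = true) i

/-- Step `j` consumes a token from the place `p(k-)`, where `q` is `(p, k)`. -/
def Uses (q : P × Fin N.maxConst) (j : ℕ) : Prop :=
  ∃ t, r.act j = some t ∧ SPlace.tok q.1 (.minus q.2) ∈ N.sInput N.maxConst t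

open Classical in
/-- The number of tokens consumed from `p(k-)` before step `i`. -/
noncomputable def served (q : P × Fin N.maxConst) (i : ℕ) : ℕ := Nat.count (r.Uses q) i

/-- Orders the ways in which a token can leave a place `p(k-)` by the time at which its age becomes
an integer. -/
def stepKey (j : ℕ) : ℕ∞ :=
  match r.act j with
  | some (.reach _ _) => ((2 * r.phase j + 1 : ℕ) : ℕ∞)
  | some (.exceed _ _) => ((2 * r.phase j : ℕ) : ℕ∞)
  | _ => ⊤

/-- The key of the step that consumes the `n`-th token of `p(k-)`, where tokens are consumed in
the order of their arrival. -/
noncomputable def key (q : P × Fin N.maxConst) (n : ℕ) : ℕ∞ :=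
  ⨅ (j) (_ : r.Uses q j ∧ r.served q j = n), r.stepKey j

theorem phase_zero : r.phase 0 = 0 := rfl

theorem phase_succ_some {i : ℕ} {t} (h : r.act i = some t) : r.phase (i + 1) = r.phase i := by
  simp [phase, Nat.count_succ, h]

theorem phase_succ_none {i : ℕ} (h : r.act i = none) : r.phase (i + 1) = r.phase i + 1 := by
  simp [phase, Nat.count_succ, h]

theorem served_zero (q) : r.served q 0 = 0 := by simp [served]

theorem served_succ_none (q) {i : ℕ} (h : r.act i = none) : r.served q (i + 1) = r.served q i := by
  simp [served, Nat.count_succ, Uses, h]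

open Classical in
theorem served_succ_some (q) {i : ℕ} {t} (h : r.act i = some t) :
    r.served q (i + 1) = r.served q i +
      if SPlace.tok q.1 (.minus q.2) ∈ N.sInput N.maxConst t then 1 else 0 := by
  simp [served, Nat.count_succ, Uses, h]

/-- At most one consuming step has a given number of predecessors, so the infimum defining `key` has
a single term; for a token never consumed it is empty and equals `⊤`. -/
theorem key_served {q} {j : ℕ} (h : r.Uses q j) : r.key q (r.served q j) = r.stepKey j := by
  classical
  refine le_antisymm (iInf₂_le j ⟨h, rfl⟩) (le_iInf₂ fun j' hj' => ?_)
  rw [Nat.count_injective hj'.1 h hj'.2]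

theorem control (i : ℕ) : r.μ i .disc + r.μ i .time1 + r.μ i .time2 = 1 := by
  induction i with
  | zero => simp [r.std.1, r.std.2.1, r.std.2.2.1]
  | succ i ih =>
    rcases h : r.act i with _ | t
    · have := r.trans i h
      have h0 := this.1 .time1 (by simp [TPN.toSDTN])
      have h1 := this.2 .time1
      have h2 := this.2 .time2
      have h3 := this.2 .disc
      simp [TPN.toSDTN] at h1 h2 h3
      omega
    · have hf := r.fires i t h
      have h0 := hf.1
      have h1 := hf.balance .time1
      have h2 := hf.balance .time2
      have h3 := hf.balance .disc
      cases t with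
      | disc t A B hA hB =>
        have hA' := control_notMem_of_mem_encArcs hA
        have hB' := control_notMem_of_mem_encArcs hB
        simp [TPN.toSDTN, TPN.sInput, TPN.sOutput, hA', hB'] at h1 h2 h3
        omega
      | _ =>
        simp [TPN.toSDTN, TPN.sInput, TPN.sOutput] at h0 h1 h2 h3
        omega

/-- A transfer step separates a discrete phase from a later time phase. -/
theorem phase_lt {i j : ℕ} (hij : i ≤ j) (hi : r.μ i .disc = 1) (hj : 1 ≤ r.μ j .time2) :
    r.phase i < r.phase j := by
  have hc := r.control
  -- Only the transfer can newly mark `time2`, so until it occurs that place remains empty.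
  suffices ∀ j, i ≤ j → r.phase i < r.phase j ∨ (r.phase i ≤ r.phase j ∧ r.μ j .time2 = 0) by
    rcases this j hij with h | h
    · exact h
    · omega
  intro j hij
  induction j, hij using Nat.le_induction with
  | base => right; have := hc i; exact ⟨le_rfl, by omega⟩
  | succ j hij ih =>
    rcases h : r.act j with _ | t
    · left
      rw [r.phase_succ_none h]
      omega
    · rw [r.phase_succ_some h]
      rcases ih with ih | ⟨ih, h2⟩
      · exact .inl ih
      · right
        refine ⟨ih, ?_⟩
        have hf := r.fires j t h
        have h0 := hf.1
        have h1 := hf.balance .time2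
        cases t with
        | disc t A B hA hB =>
          have hA' := control_notMem_of_mem_encArcs hA
          have hB' := control_notMem_of_mem_encArcs hB
          simp [TPN.toSDTN, TPN.sInput, TPN.sOutput, hA', hB'] at h1
          omega
        | _ =>
          simp [TPN.toSDTN, TPN.sInput, TPN.sOutput] at h0 h1
          omega

theorem phase_pos {j : ℕ} (hj : 1 ≤ r.μ j .time2) : 0 < r.phase j :=
  r.phase_zero ▸ r.phase_lt (Nat.zero_le j) r.std.1 hj

/-- In a discrete phase, no token that is present or still to come has been scheduled for the
past. -/
theorem le_key {i n : ℕ} {q} (hi : r.μ i .disc = 1) (hn : r.served q i ≤ n) :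
    ((2 * r.phase i + 2 : ℕ) : ℕ∞) ≤ r.key q n := by
  classical
  refine le_iInf₂ fun j hj => ?_
  -- The queue discipline: a token not yet consumed at step `i` can only be consumed at step `i` or
  -- later.
  have hij : i ≤ j := by
    by_contra! h
    have h1 : r.served q (j + 1) ≤ r.served q i := Nat.count_monotone _ h
    have h2 : r.served q (j + 1) = r.served q j + 1 := by simp [served, Nat.count_succ, hj.1]
    omega
  rcases h : r.act j with _ | t
  · simp [stepKey, h]
  · have h0 := (r.fires j t h).1 .time2
    cases t with
    | reach p k | exceed p k =>
      have := r.phase_lt hij hi (h0 (by simp [TPN.toSDTN, TPN.sInput]))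
      simp only [stepKey, h, Nat.cast_le]
      omega
    | _ => simp [stepKey, h]

open Classical in
/-- The computation contains infinitely many transitions that simulate a discrete one. -/
theorem infinitely_often_disc (i : ℕ) :
    ∃ j, i ≤ j ∧ ∃ t A B hA hB, r.act j = some (.disc t A B hA hB) := by
  by_contra! hcon
  -- A potential that strictly decreases in every step not simulating a discrete transition. The
  -- weights 3, 2, 1 make the cycle `count`, `time1`, `time2`, `disc` descend, and each `reach` or
  -- `exceed` uses up a token of the first sum.
  let Φ : ℕ → ℕ := fun j => (∑ q : P × Fin N.maxConst, r.μ j (.tok q.1 (.minus q.2))) +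
    3 * r.μ j .count + 2 * r.μ j .time1 + r.μ j .time2
  have hdec : ∀ j, i ≤ j → Φ (j + 1) < Φ j := by
    intro j hj
    rcases h : r.act j with _ | t
    · have := r.trans j h
      have h0 := this.1 .time1 (by simp [TPN.toSDTN])
      have h1 := this.2 .time1
      have h2 := this.2 .time2
      have h3 := this.2 .count
      have h4 : ∀ q : P × Fin N.maxConst, r.μ (j + 1) (.tok q.1 (.minus q.2)) =
          r.μ j (.tok q.1 (.minus q.2)) := fun q => by
        have := this.2 (.tok q.1 (.minus q.2))
        simp [TPN.toSDTN] at this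
        exact this
      simp [TPN.toSDTN] at h1 h2 h3
      simp only [Φ, h4]
      omega
    · have hf := r.fires j t h
      have h0 := hf.1
      have h1 := hf.balance .time1
      have h2 := hf.balance .time2
      have h3 := hf.balance .count
      have h4 := fun q : P × Fin N.maxConst => hf.balance (.tok q.1 (.minus q.2))
      have h5 : (∑ q : P × Fin N.maxConst, r.μ (j + 1) (.tok q.1 (.minus q.2))) + _ = _ :=
        Finset.sum_add_distrib.symm.trans
          ((Finset.sum_congr rfl fun q _ => h4 q).trans Finset.sum_add_distrib)
      cases t with
      | disc t A B hA hB => exact absurd h (hcon j hj t A B hA hB)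
      | reach p k | exceed p k =>
        have h6 : (∑ q : P × Fin N.maxConst, if q.1 = p ∧ q.2 = k then 1 else 0) = 1 := by
          rw [Finset.sum_eq_single (p, k)] <;> simp [Prod.ext_iff]
        simp [TPN.toSDTN, TPN.sInput, TPN.sOutput] at h0 h1 h2 h3 h5
        simp only [Finset.card_filter, h6] at h5
        simp only [Φ]
        omega
      | _ =>
        simp [TPN.toSDTN, TPN.sInput, TPN.sOutput] at h0 h1 h2 h3 h5
        simp only [Φ, h5]
        omega
  have : ∀ n, Φ (i + n) + n ≤ Φ i := by
    intro n
    induction n with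
    | zero => simp
    | succ n ih => have := hdec (i + n) (by omega); rw [← add_assoc i]; omega
  have := this (Φ i + 1)
  omega

/-! ### The passage of time -/

/-- The time that has passed before step `i`, where a token with key `κ` has the fractional part
`F κ` at the beginning. -/
noncomputable def clock (F : ℕ∞ → ℝ≥0) (i : ℕ) : ℝ≥0 :=
  if r.phase i = 0 then 0 else 1 - F ((2 * r.phase i + 1 : ℕ) : ℕ∞)

variable {F : ℕ∞ → ℝ≥0}

theorem clock_zero : r.clock F 0 = 0 := by simp [clock, phase_zero]

theorem clock_succ_some {i : ℕ} {t} (h : r.act i = some t) :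
    r.clock F (i + 1) = r.clock F i := by
  simp [clock, r.phase_succ_some h]

/-- In phase j ≥ 1 the tokens with key 2j+1 are exactly at an integer. Phase 0 is excluded since no
time has passed there; no token crosses an integer in it. -/
theorem clock_add_eq (hF1 : ∀ κ, F κ < 1) {i : ℕ} (h : 0 < r.phase i) :
    r.clock F i + F ((2 * r.phase i + 1 : ℕ) : ℕ∞) = 1 := by
  rw [clock, if_neg h.ne', tsub_add_cancel_of_le (hF1 _).le]

theorem clock_add_lt (hF : StrictAnti F) (hF1 : ∀ κ, F κ < 1) {i : ℕ} {κ : ℕ∞}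
    (h : ((2 * r.phase i + 1 : ℕ) : ℕ∞) < κ) : r.clock F i + F κ < 1 := by
  by_cases h0 : r.phase i = 0
  · simp [clock, h0, hF1]
  · rw [← r.clock_add_eq hF1 (Nat.pos_of_ne_zero h0)]
    gcongr
    exact hF h

theorem clock_add_top_lt (hF : StrictAnti F) (hF1 : ∀ κ, F κ < 1) (i : ℕ) :
    r.clock F i + F ⊤ < 1 :=
  r.clock_add_lt hF hF1 (ENat.natCast_lt_top _)

/-- The even key 2j fits between the odd keys of consecutive phases, so in phase j such a token is
already past the integer. -/
theorem lt_clock_add (hF : StrictAnti F) (hF1 : ∀ κ, F κ < 1) {i : ℕ} (h : 0 < r.phase i) :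
    1 < r.clock F i + F ((2 * r.phase i : ℕ) : ℕ∞) := by
  rw [← r.clock_add_eq hF1 h]
  gcongr
  exact hF (by exact_mod_cast Nat.lt_succ_self _)

theorem clock_lt_succ_none (hF : StrictAnti F) (hF1 : ∀ κ, F κ < 1) {i : ℕ} (h : r.act i = none) :
    r.clock F i < r.clock F (i + 1) := by
  have hp := r.phase_succ_none h
  have h1 := r.clock_add_eq hF1 (i := i + 1) (by omega)
  refine lt_of_add_lt_add_right ?_ (a := F ((2 * r.phase (i + 1) + 1 : ℕ) : ℕ∞))
  rw [h1]
  exact r.clock_add_lt hF hF1 (by rw [hp]; norm_cast; omega)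

theorem clock_mono (hF : StrictAnti F) (hF1 : ∀ κ, F κ < 1) : Monotone (r.clock F) := by
  refine monotone_nat_of_le_succ fun i => ?_
  rcases h : r.act i with _ | t
  · exact (r.clock_lt_succ_none hF hF1 h).le
  · exact (r.clock_succ_some h).ge

end StdRun

/-! ### Simulation by the timed net -/

/-- The marking with the ages `Z p s` of tokens on `p`, for all `p` and `s`. -/
def ageTokens {P : Type*} [Fintype P] {m : ℕ} (Z : P → AgeSym m → Multiset ℝ≥0) : TPN.Marking P :=
  ∑ p, ∑ s, (Z p s).map (Prod.mk p)

theorem ageTokens_add {P : Type*} [Fintype P] {m : ℕ} (Z Z' : P → AgeSym m → Multiset ℝ≥0) :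
    ageTokens (fun p s => Z p s + Z' p s) = ageTokens Z + ageTokens Z' := by
  simp [ageTokens, Finset.sum_add_distrib]

theorem age_ageTokens {P : Type*} [Fintype P] {m : ℕ} (Z : P → AgeSym m → Multiset ℝ≥0)
    (d : ℝ≥0) : TPN.age (ageTokens Z) d = ageTokens fun p s => (Z p s).map (· + d) := by
  have h (s : TPN.Marking P) : s.map (fun q => (q.1, q.2 + d)) =
    Multiset.mapAddMonoidHom (fun q : P × ℝ≥0 => (q.1, q.2 + d)) s := rfl
  rw [TPN.age, h, ageTokens, map_sum]
  simp [ageTokens, map_sum, Multiset.map_map]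

/-- One token on each `p(s p)` with `p` in a set `D` of places. -/
theorem ageTokens_indicator {P : Type*} [Fintype P] {m : ℕ} (D : P → Prop) [DecidablePred D]
    (s : P → AgeSym m) [∀ p s', Decidable (D p ∧ s' = s p)] (x : P → AgeSym m → ℝ≥0) :
    ageTokens (fun p s' => if D p ∧ s' = s p then {x p s'} else 0) =
      (Finset.univ.filter D).val.map fun p => (p, x p (s p)) := by
  have h : ∀ p, ∑ s', (if D p ∧ s' = s p then ({x p s'} : Multiset ℝ≥0) else 0).map (Prod.mk p) =
      if D p then {(p, x p (s p))} else 0 := by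
    intro p
    rw [Finset.sum_eq_single (s p)]
    · by_cases hD : D p <;> simp [hD]
    · intro b _ hb
      simp [hb]
    · simp
  simp only [ageTokens, h]
  rw [← Finset.sum_filter]
  have := Multiset.sum_map_singleton ((Finset.univ.filter D).val.map fun p => (p, x p (s p)))
  rwa [Multiset.map_map] at this

namespace StdRun

variable {P T : Type*} [Fintype P] [Fintype T] {N : TPN P T} (r : StdRun N) (F : ℕ∞ → ℝ≥0)

/-- The age at step `i` of the `n`-th token of the place `p(k-)`. -/
noncomputable def minusAge (i : ℕ) (q : P × Fin N.maxConst) (n : ℕ) : ℝ≥0 :=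
  ((q.2 : ℕ) : ℝ≥0) + F (r.key q n) + r.clock F i

/-- `x` may be the age of a token on `p(s)` at step `i`; for `s = k-`, of the `n`-th one. -/
def AgeOK (i : ℕ) (p : P) (n : ℕ) : AgeSym N.maxConst → ℝ≥0 → Prop
  | .exact k, x => x = (k : ℕ)
  | .plus k, x => ((k : ℕ) : ℝ≥0) < x ∧ ((k : ℕ) < N.maxConst → x < (k : ℕ) + F ⊤ + r.clock F i)
  | .minus k, x => x = r.minusAge F i (p, k) n

/-- The ages `Z p s` represent the tokens on `p(s)` at step `i`. -/
structure Represents (i : ℕ) (Z : P → AgeSym N.maxConst → Multiset ℝ≥0) : Prop where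
  card : ∀ p s, (Z p s).card = r.μ i (.tok p s)
  exact : ∀ p k, ∀ x ∈ Z p (.exact k), x = ((k : ℕ) : ℝ≥0)
  plus : ∀ p (k : Fin (N.maxConst + 1)), ∀ x ∈ Z p (.plus k),
    ((k : ℕ) : ℝ≥0) < x ∧ ((k : ℕ) < N.maxConst → x < (k : ℕ) + F ⊤ + r.clock F i)
  minus : ∀ p k, Z p (.minus k) =
    ∑ n ∈ Finset.Ico (r.served (p, k) i) (r.served (p, k) i + r.μ i (.tok p (.minus k))),
      {r.minusAge F i (p, k) n}

/-- The invariant of the simulation. -/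
def Simulates (i : ℕ) (M : TPN.Marking P) : Prop := ∃ Z, r.Represents F i Z ∧ ageTokens Z ≤ M

variable {F} {r}

-- Bookkeeping common to all ordinary transitions: take out the front token of each queue p(k-)
-- involved, or any token of the other input places, then append the new ones. A place that is both
-- input and output really exchanges its token, although its count is unchanged.
open Classical in
theorem Represents.fires {i : ℕ} {Z} (hZ : r.Represents F i Z) {t} (ht : r.act i = some t)
    (y : P → AgeSym N.maxConst → ℝ≥0)
    (hy : ∀ p s, .tok p s ∈ N.sOutput N.maxConst t →
      r.AgeOK F i p (match s with
        | .minus k => r.served (p, k) i + r.μ i (.tok p (.minus k)) | _ => 0) s (y p s)) :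
    ∃ (x : P → AgeSym N.maxConst → ℝ≥0) (Z₀ : P → AgeSym N.maxConst → Multiset ℝ≥0),
      (∀ p s, Z p s = Z₀ p s + if .tok p s ∈ N.sInput N.maxConst t then {x p s} else 0) ∧
      (∀ p k, x p (.minus k) = r.minusAge F i (p, k) (r.served (p, k) i)) ∧
      r.Represents F (i + 1)
        (fun p s => Z₀ p s + if .tok p s ∈ N.sOutput N.maxConst t then {y p s} else 0) := by
  have hf := r.fires i t ht
  have hin : ∀ p s, .tok p s ∈ N.sInput N.maxConst t → 1 ≤ r.μ i (.tok p s) := fun p s h => hf.1 _ h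
  have hbal : ∀ p s, r.μ (i + 1) (.tok p s) +
      (if .tok p s ∈ N.sInput N.maxConst t then 1 else 0) =
      r.μ i (.tok p s) + if .tok p s ∈ N.sOutput N.maxConst t then 1 else 0 :=
    fun p s => hf.balance (.tok p s)
  have hx : ∀ p s, ∃ (x : ℝ≥0) (z₀ : Multiset ℝ≥0),
      (Z p s = z₀ + if .tok p s ∈ N.sInput N.maxConst t then {x} else 0) ∧
      (∀ k, s = .minus k → x = r.minusAge F i (p, k) (r.served (p, k) i) ∧
        z₀ = ∑ n ∈ Finset.Ico (r.served (p, k) (i + 1))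
          (r.served (p, k) i + r.μ i (.tok p (.minus k))), {r.minusAge F i (p, k) n}) := by
    intro p s
    by_cases hs : ∃ k, s = .minus k
    · obtain ⟨k, rfl⟩ := hs
      refine ⟨r.minusAge F i (p, k) (r.served (p, k) i),
        ∑ n ∈ Finset.Ico (r.served (p, k) (i + 1))
          (r.served (p, k) i + r.μ i (.tok p (.minus k))), {r.minusAge F i (p, k) n}, ?_,
        by rintro _ ⟨⟩; exact ⟨rfl, rfl⟩⟩
      rw [hZ.minus, r.served_succ_some _ ht]
      by_cases h : .tok p (.minus k) ∈ N.sInput N.maxConst t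
      · have := hin p _ h
        rw [Finset.sum_eq_sum_Ico_succ_bot (by omega), add_comm]
        simp [h]
      · simp [h]
    · have hs' : ∀ k, s ≠ .minus k := fun k h => hs ⟨k, h⟩
      by_cases h : .tok p s ∈ N.sInput N.maxConst t
      · have h1 := hin p _ h
        -- Outside the queues the choice of the removed token is irrelevant.
        rw [← hZ.card, Nat.succ_le_iff, Multiset.card_pos_iff_exists_mem] at h1
        obtain ⟨x, hx⟩ := h1
        obtain ⟨z, hz⟩ := Multiset.exists_cons_of_mem hx
        refine ⟨x, z, ?_, fun k h => absurd h (hs' k)⟩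
        rw [hz, if_pos h, add_comm, Multiset.singleton_add]
      · exact ⟨0, _, by rw [if_neg h, add_zero], fun k h => absurd h (hs' k)⟩
  choose x Z₀ hx hm using hx
  refine ⟨x, Z₀, hx, fun p k => (hm p _ k rfl).1, ?_⟩
  have hsub : ∀ p s, ∀ a ∈ Z₀ p s, a ∈ Z p s := fun p s a ha => by
    rw [hx]; exact Multiset.mem_add.2 (.inl ha)
  have hmem : ∀ p s a, (a ∈ Z₀ p s + if .tok p s ∈ N.sOutput N.maxConst t then {y p s} else 0) →
      a ∈ Z p s ∨ (.tok p s ∈ N.sOutput N.maxConst t ∧ a = y p s) := by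
    intro p s a ha
    rcases Multiset.mem_add.1 ha with ha | ha
    · exact .inl (hsub p s a ha)
    · split_ifs at ha with h
      · exact .inr ⟨h, by simpa using ha⟩
      · simp at ha
  refine ⟨fun p s => ?_, fun p k a ha => ?_, fun p k a ha => ?_, fun p k => ?_⟩
  · have h1 := congrArg Multiset.card (hx p s)
    have h2 := hbal p s
    rw [hZ.card, Multiset.card_add] at h1
    rw [Multiset.card_add]
    split_ifs at h1 h2 ⊢ <;> simp at h1 ⊢ <;> omega
  · rcases hmem _ _ _ ha with h | ⟨h, rfl⟩
    · exact hZ.exact p k a h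
    · exact hy p _ h
  · rw [r.clock_succ_some ht]
    rcases hmem _ _ _ ha with h | ⟨h, rfl⟩
    · exact hZ.plus p k a h
    · exact hy p _ h
  · have hclock : r.minusAge F (i + 1) (p, k) = r.minusAge F i (p, k) := by
      funext n; simp [minusAge, r.clock_succ_some ht]
    have h2 := hbal p (.minus k)
    have h3 := r.served_succ_some (p, k) ht
    have h4 := hin p (.minus k)
    simp only at h3
    rw [(hm p _ k rfl).2, hclock]
    by_cases ho : .tok p (.minus k) ∈ N.sOutput N.maxConst t
    · have h5 : y p (.minus k) = r.minusAge F i (p, k) _ := hy p _ ho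
      rw [if_pos ho] at h2 ⊢
      rw [h5, ← Finset.sum_Ico_succ_top (f := fun n => ({r.minusAge F i (p, k) n} : Multiset ℝ≥0))]
      · congr 2
        omega
      · split_ifs at h3 with h
        · have := h4 h
          omega
        · omega
    · rw [if_neg ho] at h2 ⊢
      rw [add_zero]
      congr 2
      omega

variable (hF : StrictAnti F) (hF0 : ∀ κ, 0 < F κ) (hF1 : ∀ κ, F κ < 1)
include hF hF0 hF1

/-- The clock strictly advances, so exact ages k become k+. Their new excess is the increment of the
clock, which respects the bound on k+ because F(⊤) > 0. -/
theorem Represents.trans {i : ℕ} {Z} (hZ : r.Represents F i Z) (ht : r.act i = none) :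
    ∃ Z', r.Represents F (i + 1) Z' ∧
      ageTokens Z' = TPN.age (ageTokens Z) (r.clock F (i + 1) - r.clock F i) := by
  have hst := r.trans i ht
  set d := r.clock F (i + 1) - r.clock F i with hd
  have hlt := r.clock_lt_succ_none hF hF1 ht
  have hdpos : 0 < d := tsub_pos_of_lt hlt
  have hcd : r.clock F (i + 1) = r.clock F i + d := (add_tsub_cancel_of_le hlt.le).symm
  have hexact : ∀ p k, r.μ (i + 1) (.tok p (.exact k)) = 0 := fun p k =>
    (hst.2 (.tok p (.exact k))).2.2.2.1 (.tok p (.plus k)) (.inl ⟨p, k, rfl⟩)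
  have hplus : ∀ p k, r.μ (i + 1) (.tok p (.plus k)) =
      r.μ i (.tok p (.plus k)) + r.μ i (.tok p (.exact k)) := fun p k =>
    (hst.2 (.tok p (.plus k))).2.2.2.2.1 (.tok p (.exact k)) (.inl ⟨p, k, rfl⟩)
  have hminus : ∀ p k, r.μ (i + 1) (.tok p (.minus k)) = r.μ i (.tok p (.minus k)) := fun p k => by
    have := hst.2 (.tok p (.minus k))
    simp [TPN.toSDTN] at this
    exact this
  refine ⟨fun p s => match s with
    | .exact _ => 0
    | .plus k => (Z p (.plus k) + Z p (.exact k)).map (· + d)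
    | .minus k => (Z p (.minus k)).map (· + d), ⟨fun p s => ?_, fun p k x hx => ?_,
      fun p k x hx => ?_, fun p k => ?_⟩, ?_⟩
  · cases s with
    | exact k => simp [hexact]
    | plus k => simp [hplus, hZ.card]
    | minus k => simp [hminus, hZ.card]
  · simp at hx
  · obtain ⟨x, hx', rfl⟩ := Multiset.mem_map.1 hx
    rw [hcd]
    rcases Multiset.mem_add.1 hx' with hx | hx
    · obtain ⟨h1, h2⟩ := hZ.plus p k x hx
      refine ⟨h1.trans_le le_self_add, fun hk => ?_⟩
      rw [← add_assoc]
      gcongr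
      exact h2 hk
    · obtain rfl := hZ.exact p k x hx
      refine ⟨lt_add_of_pos_right _ hdpos, fun _ => ?_⟩
      rw [← add_assoc]
      gcongr
      rw [add_assoc]
      exact lt_add_of_pos_right _ (add_pos_of_pos_of_nonneg (hF0 ⊤) zero_le)
  · simp only [hminus, r.served_succ_none _ ht, hZ.minus]
    rw [← Multiset.coe_mapAddMonoidHom, map_sum]
    simp [minusAge, hcd, add_assoc]
  · rw [age_ageTokens]
    simp [ageTokens, AgeSym.sum_eq, Finset.sum_add_distrib, Multiset.map_add]
    abel

end StdRun

namespace StdRun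

variable {P T : Type*} [Fintype P] [Fintype T] {N : TPN P T} (r : StdRun N) (F : ℕ∞ → ℝ≥0)

/-- The action of the timed net that corresponds to step `i`. -/
noncomputable def timedAct (i : ℕ) : TPN.Action T :=
  match r.act i with
  | some (.disc t _ _ _ _) => .disc t
  | none => .time (r.clock F (i + 1) - r.clock F i)
  | _ => .time 0

variable {r F}

/-- In a discrete phase j the keys of queued or newly queued tokens are at least 2j+2, so these
tokens have not reached the next integer; tokens at k+ are kept below it by F(⊤) plus the clock
being less than 1. -/
theorem AgeOK.denotes (hF : StrictAnti F) (hF0 : ∀ κ, 0 < F κ) (hF1 : ∀ κ, F κ < 1) {i : ℕ} {p : P}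
    {n : ℕ} {s : AgeSym N.maxConst} {x : ℝ≥0} (h : r.AgeOK F i p n s x) (hi : r.μ i .disc = 1)
    (hn : ∀ k, s = .minus k → r.served (p, k) i ≤ n) : s.Denotes x := by
  cases s with
  | exact k => exact h
  | plus k =>
    refine ⟨h.1, fun hk => (h.2 hk).trans ?_⟩
    rw [add_assoc, add_comm (F ⊤)]
    gcongr
    exact r.clock_add_top_lt hF hF1 i
  | minus k =>
    have h' : x = ((k : ℕ) : ℝ≥0) + F (r.key (p, k) n) + r.clock F i := h
    rw [h', add_assoc]
    refine ⟨lt_add_of_pos_right _ (add_pos_of_pos_of_nonneg (hF0 _) zero_le), ?_⟩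
    gcongr
    rw [add_comm]
    refine r.clock_add_lt hF hF1 (lt_of_lt_of_le ?_ (r.le_key hi (hn k rfl)))
    exact_mod_cast Nat.lt_succ_self _

theorem Simulates.disc (hF : StrictAnti F) (hF0 : ∀ κ, 0 < F κ) (hF1 : ∀ κ, F κ < 1) {i : ℕ}
    {M : TPN.Marking P} (h : r.Simulates F i M) {t A B hA hB}
    (ht : r.act i = some (.disc t A B hA hB)) :
    ∃ M', N.DiscStep t M M' ∧ r.Simulates F (i + 1) M' := by
  classical
  obtain ⟨Z, hZ, hM⟩ := h
  have hi : r.μ i .disc = 1 := by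
    have h0 := (r.fires i _ ht).1 .disc (by simp [TPN.toSDTN, TPN.sInput])
    have := r.control i
    omega
  obtain ⟨s, hs, hAs⟩ := id hA
  obtain ⟨s', hs', hBs⟩ := id hB
  have hin : ∀ p a, (.tok p a ∈ N.sInput N.maxConst (.disc t A B hA hB)) ↔
      (N.In t p).isSome ∧ a = s p := by
    intro p a
    simp [TPN.sInput, hAs]
  have hout : ∀ p a, (.tok p a ∈ N.sOutput N.maxConst (.disc t A B hA hB)) ↔
      (N.Out t p).isSome ∧ a = s' p := by
    intro p a
    simp [TPN.sOutput, hBs]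
  let idx : P → AgeSym N.maxConst → ℕ := fun p a => match a with
    | .minus k => r.served (p, k) i + r.μ i (.tok p (.minus k)) | _ => 0
  -- The ages of the tokens to be produced: any excess strictly between 0 and F(⊤) serves for k+,
  -- while a new token on p(k-) joins the end of its queue with the age its future consumption
  -- requires.
  let y : P → AgeSym N.maxConst → ℝ≥0 := fun p a => match a with
    | .exact k => (k : ℕ)
    | .plus k => (k : ℕ) + F ⊤ / 2
    | .minus k => r.minusAge F i (p, k) (r.served (p, k) i + r.μ i (.tok p (.minus k)))
  have hy : ∀ p a, r.AgeOK F i p (idx p a) a (y p a) := by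
    intro p a
    cases a with
    | exact k => rfl
    | plus k =>
      refine ⟨lt_add_of_pos_right _ (half_pos (hF0 _)), fun _ => ?_⟩
      rw [add_assoc]
      simp only [y]
      gcongr
      exact lt_add_of_lt_of_nonneg (half_lt_self (hF0 _)) zero_le
    | minus k => rfl
  obtain ⟨x, Z₀, hx, hxm, hR⟩ := hZ.fires ht y fun p a _ => hy p a
  simp only [hin] at hx
  simp only [hout] at hR
  have hxd : ∀ p, (N.In t p).isSome → (s p).Denotes (x p (s p)) := by
    intro p hp
    have hmem : x p (s p) ∈ Z p (s p) := by
      rw [hx]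
      simp [hp]
    refine AgeOK.denotes (r := r) (p := p)
      (n := match s p with | .minus k => r.served (p, k) i | _ => 0) hF hF0 hF1 ?_ hi ?_
    · generalize s p = a at hmem
      cases a with
      | exact k => exact hZ.exact p k _ hmem
      | plus k => exact hZ.plus p k _ hmem
      | minus k => exact hxm p k
    · intro k hk
      simp [hk]
  have hyd : ∀ p, (s' p).Denotes (y p (s' p)) := fun p =>
    (hy p (s' p)).denotes hF hF0 hF1 hi (by intro k hk; simp [idx, hk])
  have hZsum : ageTokens Z = ageTokens Z₀ +
      (Finset.univ.filter fun p => (N.In t p).isSome).val.map fun p => (p, x p (s p)) := by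
    rw [← ageTokens_indicator (fun p => (N.In t p).isSome = true) s x, ← ageTokens_add]
    congr 1
    funext p a
    exact hx p a
  have hZsum' := ageTokens_indicator (fun p => (N.Out t p).isSome = true) s' y
  rw [hZsum] at hM
  obtain ⟨C, rfl⟩ := Multiset.le_iff_exists_add.1 hM
  refine ⟨_, ⟨_, _, ageTokens Z₀ + C, ⟨fun p => x p (s p), fun p I hI => ?_, rfl⟩,
    ⟨fun p => y p (s' p), fun p I hI => ?_, rfl⟩, by abel, rfl⟩, _, hR, ?_⟩
  · exact (hxd p (by simp [hI])).mem_ages (hs p I hI) (N.In_maxConst_le hI)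
  · exact (hyd p).mem_ages (hs' p I hI) (N.Out_maxConst_le hI)
  · rw [ageTokens_add, hZsum', add_assoc, add_comm C, ← add_assoc]
    exact Multiset.le_add_right _ _

/-- Moving one token to another symbol without changing its age. -/
theorem Simulates.move {i : ℕ} {M : TPN.Marking P} (h : r.Simulates F i M) {t}
    (ht : r.act i = some t) (p : P) (k : Fin N.maxConst) (b : AgeSym N.maxConst)
    (hin : ∀ q a, .tok q a ∈ N.sInput N.maxConst t ↔ q = p ∧ a = .minus k)
    (hout : ∀ q a, .tok q a ∈ N.sOutput N.maxConst t ↔ q = p ∧ a = b)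
    (hb : ∀ n, r.AgeOK F i p n b (r.minusAge F i (p, k) (r.served (p, k) i))) :
    r.Simulates F (i + 1) M := by
  classical
  obtain ⟨Z, hZ, hM⟩ := h
  obtain ⟨x, Z₀, hx, hxm, hR⟩ := hZ.fires ht
    (fun _ _ => r.minusAge F i (p, k) (r.served (p, k) i)) fun q a hqa => by
      obtain ⟨rfl, rfl⟩ := (hout q a).1 hqa
      exact hb _
  refine ⟨_, hR, ?_⟩
  simp only [hin] at hx
  simp only [hout]
  have hZ' : Z = fun q a => Z₀ q a + if q = p ∧ a = .minus k then {x q a} else 0 := by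
    funext q a
    exact hx q a
  rw [hZ', ageTokens_add] at hM
  rw [ageTokens_add]
  convert hM using 2
  have h1 := ageTokens_indicator (fun q => q = p) (fun _ => b)
    (fun _ _ => r.minusAge F i (p, k) (r.served (p, k) i))
  have h2 := ageTokens_indicator (fun q => q = p) (fun _ => .minus k) x
  rw [h1, h2]
  refine Multiset.map_congr rfl fun q hq => ?_
  obtain rfl : q = p := by simpa using hq
  rw [hxm]

theorem Simulates.step (hF : StrictAnti F) (hF0 : ∀ κ, 0 < F κ) (hF1 : ∀ κ, F κ < 1) {i : ℕ}
    {M : TPN.Marking P} (h : r.Simulates F i M) :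
    ∃ M', N.Step M (r.timedAct F i) M' ∧ r.Simulates F (i + 1) M' := by
  have hage : M = TPN.age M 0 := by simp [TPN.age]
  rcases ht : r.act i with _ | t
  · obtain ⟨Z, hZ, hM⟩ := h
    obtain ⟨Z', hZ', hZZ⟩ := hZ.trans hF hF0 hF1 ht
    refine ⟨_, by simp only [timedAct, ht]; rfl, Z', hZ', ?_⟩
    rw [hZZ]
    exact Multiset.map_le_map hM
  · cases t with
    | disc t A B hA hB =>
      obtain ⟨M', h1, h2⟩ := h.disc hF hF0 hF1 ht
      exact ⟨M', by simpa only [timedAct, ht], h2⟩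
    | switchTime | switchDisc =>
      refine ⟨M, by simp only [timedAct, ht]; exact hage, ?_⟩
      classical
      obtain ⟨Z, hZ, hM⟩ := h
      obtain ⟨x, Z₀, hx, -, hR⟩ := hZ.fires ht (fun _ _ => 0)
        (by intro p s h; simp [TPN.sOutput] at h)
      refine ⟨_, hR, ?_⟩
      convert hM with p s
      rw [hx]
      simp [TPN.sInput, TPN.sOutput]
    | reach p k =>
      refine ⟨M, by simp only [timedAct, ht]; exact hage, ?_⟩
      have hpos : 0 < r.phase i :=
        r.phase_pos ((r.fires i _ ht).1 .time2 (by simp [TPN.toSDTN, TPN.sInput]))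
      have hk := r.key_served (q := (p, k)) ⟨_, ht, by simp [TPN.sInput]⟩
      simp only [stepKey, ht] at hk
      refine h.move ht p k (.exact k.succ) (by simp [TPN.sInput]) (by simp [TPN.sOutput])
        fun n => ?_
      simp only [AgeOK, minusAge, hk, Fin.val_succ]
      -- The key is 2j+1 in phase j, so the fractional part and the clock add up to exactly 1.
      rw [add_assoc, add_comm (F _), r.clock_add_eq hF1 hpos, Nat.cast_succ]
    | exceed p k =>
      refine ⟨M, by simp only [timedAct, ht]; exact hage, ?_⟩
      have hpos : 0 < r.phase i :=
        r.phase_pos ((r.fires i _ ht).1 .time2 (by simp [TPN.toSDTN, TPN.sInput]))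
      have hk := r.key_served (q := (p, k)) ⟨_, ht, by simp [TPN.sInput]⟩
      simp only [stepKey, ht] at hk
      refine h.move ht p k (.plus k.succ) (by simp [TPN.sInput]) (by simp [TPN.sOutput])
        fun n => ?_
      simp only [AgeOK, minusAge, hk, Fin.val_succ, Nat.cast_succ]
      refine ⟨?_, fun _ => ?_⟩
      · rw [add_assoc, add_comm (F _)]
        gcongr
        exact r.lt_clock_add hF hF1 hpos
      -- The excess over k+1 is F(2j) + clock - 1, which is below the clock because F(2j) < 1.
      · refine add_lt_add_of_lt_of_le ?_ le_rfl
        rw [add_assoc]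
        gcongr
        exact lt_add_of_lt_of_nonneg (hF1 _) zero_le

/-- A marking related to a computation of the constructed net has a computation of delay less
than `1`. -/
theorem Simulates.mem_zenoWithin (hF : StrictAnti F) (hF0 : ∀ κ, 0 < F κ) (hF1 : ∀ κ, F κ < 1)
    {M : TPN.Marking P} (h : r.Simulates F 0 M) : M ∈ N.zenoWithin (1 - F ⊤) := by
  choose! g hg hg' using fun i M => Simulates.step (r := r) hF hF0 hF1 (i := i) (M := M)
  let m : ℕ → TPN.Marking P := fun n => Nat.rec M (fun i M => g i M) n
  have hm : ∀ i, r.Simulates F i (m i) := by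
    intro i
    induction i with
    | zero => exact h
    | succ i ih => exact hg' i _ ih
  let π : TPN.InfComputation N := ⟨m, r.timedAct F, fun i => hg i _ (hm i), fun i => by
    obtain ⟨j, hj, t, A, B, hA, hB, ht⟩ := r.infinitely_often_disc i
    exact ⟨j, hj, t, by simp only [timedAct, ht]⟩⟩
  have hdelay : ∀ i, (r.timedAct F i).delay + r.clock F i = r.clock F (i + 1) := by
    intro i
    rcases ht : r.act i with _ | t
    · simp only [timedAct, ht, TPN.Action.delay]
      exact tsub_add_cancel_of_le (r.clock_mono hF hF1 (Nat.le_succ i))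
    · rw [r.clock_succ_some ht]
      cases t <;> simp [timedAct, ht, TPN.Action.delay]
  -- The delays telescope, so a bound on the clock bounds every partial sum.
  have hsum : ∀ n, ∑ i ∈ Finset.range n, (r.timedAct F i).delay = r.clock F n := by
    intro n
    induction n with
    | zero => simp [r.clock_zero]
    | succ n ih => rw [Finset.sum_range_succ, ih, add_comm, hdelay]
  have hle : π.delay ≤ ((1 - F ⊤ : ℝ≥0) : ℝ≥0∞) := by
    refine ENNReal.tsum_le_of_sum_range_le fun n => ?_
    rw [← ENNReal.ofNNReal_finsetSum, hsum, ENNReal.coe_le_coe]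
    exact le_tsub_of_add_le_right (r.clock_add_top_lt hF hF1 n).le
  refine ⟨π, rfl, ?_⟩
  calc (π.delay : EReal) ≤ (((1 - F ⊤ : ℝ≥0) : ℝ≥0∞) : EReal) := by exact_mod_cast hle
    _ = ((1 - F ⊤ : ℝ) : EReal) := by
      rw [EReal.coe_nnreal_eq_coe_real, NNReal.coe_sub (hF1 _).le, NNReal.coe_one]

end StdRun

/-! ### The word of the tokens just below an integer -/

theorem sum_length_append {α β A : Type*} [AddCommMonoid A] (u v : List α)
    (f : Fin (u ++ v).length → β) (G : α → β → A) :
    ∑ i, G ((u ++ v).get i) (f i) =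
      ∑ i : Fin u.length, G (u.get i) (f ⟨i, by simp; omega⟩) +
      ∑ i : Fin v.length, G (v.get i) (f ⟨u.length + i, by simp⟩) := by
  rw [← (finCongr (List.length_append (as := u) (bs := v)).symm).sum_comp, Fin.sum_univ_add]
  congr 1 <;> refine Finset.sum_congr rfl fun i _ => ?_
  · simp [Fin.cast, Fin.castAdd, Fin.castLE]
  · simp [Fin.cast, Fin.natAdd]

/-- A strictly increasing labelling of a list that is listed by decreasing keys comes from a
strictly antitone function of the keys. -/
theorem exists_strictAntiOn_of_sorted {κ α A : Type*} [LinearOrder κ] [AddCommMonoid A]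
    (l : List κ) (hl : l.Pairwise (· > ·)) (b : κ → α) (f : Fin (l.map b).length → ℝ≥0)
    (hf : StrictMono f) (G : α → ℝ≥0 → A) :
    ∃ F : κ → ℝ≥0, StrictAntiOn F {c | c ∈ l} ∧ (∀ c ∈ l, ∃ i, F c = f i) ∧
      ∑ i, G ((l.map b).get i) (f i) = (l.map fun c => G (b c) (F c)).sum := by
  have hlen : (l.map b).length = l.length := List.length_map _
  have hnd : l.Nodup := hl.imp fun h => h.ne'
  let F : κ → ℝ≥0 := fun c => if h : l.idxOf c < l.length then f ⟨l.idxOf c, by omega⟩ else 0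
  have hFi : ∀ i : Fin l.length, F l[i] = f ⟨i, by omega⟩ := by
    intro i
    simp [F, hnd.idxOf_getElem]
  refine ⟨F, ?_, ?_, ?_⟩
  · intro c hc d hd hcd
    obtain ⟨i, hi, rfl⟩ := List.getElem_of_mem hc
    obtain ⟨j, hj, rfl⟩ := List.getElem_of_mem hd
    rw [show F l[i] = _ from hFi ⟨i, hi⟩, show F l[j] = _ from hFi ⟨j, hj⟩]
    refine hf ?_
    rw [Fin.mk_lt_mk]
    by_contra! h
    rcases h.lt_or_eq with h | rfl
    · exact lt_asymm hcd (List.pairwise_iff_getElem.1 hl _ _ _ _ h)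
    · exact lt_irrefl _ hcd
  · intro c hc
    obtain ⟨i, hi, rfl⟩ := List.getElem_of_mem hc
    exact ⟨_, hFi ⟨i, hi⟩⟩
  · rw [← (finCongr hlen.symm).sum_comp, ← Fin.sum_univ_fun_getElem]
    refine Finset.sum_congr rfl fun i _ => ?_
    have := hFi i
    simp only [Fin.getElem_fin] at this
    simp [this, Fin.cast]

theorem Multiset.sum_replicate_count {α β : Type*} [Fintype α] [DecidableEq α] (s : Multiset α)
    (g : α → β) : ∑ a, Multiset.replicate (s.count a) (g a) = s.map g := by
  induction s using Multiset.induction_on with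
  | empty => simp
  | cons a s ih =>
    simp only [Multiset.count_cons, Multiset.replicate_add, Finset.sum_add_distrib, ih,
      Multiset.map_cons]
    rw [Finset.sum_eq_single a (by intro b _ hb; simp [hb]) (by simp), add_comm]
    simp

theorem Multiset.sum_map_filter_fst {α β : Type*} [Fintype α] [DecidableEq α]
    (s : Multiset (α × β)) :
    ∑ a, ((s.filter fun q => q.1 = a).map Prod.snd).map (Prod.mk a) = s := by
  induction s using Multiset.induction_on with
  | empty => simp
  | cons q s ih =>
    have : ∀ a, (((q ::ₘ s).filter fun q => q.1 = a).map Prod.snd).map (Prod.mk a) =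
        (if q.1 = a then {q} else 0) +
          ((s.filter fun q => q.1 = a).map Prod.snd).map (Prod.mk a) := by
      intro a
      by_cases h : q.1 = a
      · subst h
        simp
      · simp [h]
    simp only [this, Finset.sum_add_distrib, ih]
    simp

/-! ### The witness w₋ and the start of the simulation. -/

namespace StdRun

variable {P T : Type*} [Fintype P] [Fintype T] {N : TPN P T} (r : StdRun N)

open Classical in
/-- The initial tokens just below an integer that have the key `κ`. -/
noncomputable def block (κ : ℕ∞) : Multiset (P × Fin N.maxConst) :=
  ∑ q : P × Fin N.maxConst, ∑ n ∈ Finset.range (r.μ 0 (.tok q.1 (.minus q.2))),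
    if r.key q n = κ then {q} else 0

open Classical in
/-- The keys of the initial tokens just below an integer. -/
noncomputable def keys : Finset ℕ∞ :=
  Finset.univ.biUnion fun q : P × Fin N.maxConst =>
    (Finset.range (r.μ 0 (.tok q.1 (.minus q.2)))).image (r.key q)

/-- The initial tokens just below an integer, by decreasing key. -/
noncomputable def minusWord : List (Multiset (P × Fin N.maxConst)) :=
  (r.keys.sort (· ≥ ·)).map r.block

theorem key_mem_keys {q : P × Fin N.maxConst} {n : ℕ} (h : n < r.μ 0 (.tok q.1 (.minus q.2))) :
    r.key q n ∈ r.keys := by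
  classical
  exact Finset.mem_biUnion.2 ⟨q, Finset.mem_univ _,
    Finset.mem_image.2 ⟨n, Finset.mem_range.2 h, rfl⟩⟩

theorem sum_sort_keys {A : Type*} [AddCommMonoid A] (g : ℕ∞ → A) :
    ((r.keys.sort (· ≥ ·)).map g).sum = ∑ κ ∈ r.keys, g κ := by
  rw [Finset.sum, ← Finset.sort_eq r.keys (· ≥ ·), Multiset.map_coe, Multiset.sum_coe]

/-- Exchanging sums turns a sum over letters into one over individual tokens. It is used twice: with
counting maps for membership in perm(M'⁻), and with maps attaching ages for the decomposition of the
marking. -/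
theorem sum_block {A : Type*} [AddCommMonoid A] (φ : ℕ∞ → Multiset (P × Fin N.maxConst) →+ A) :
    ∑ κ ∈ r.keys, φ κ (r.block κ) = ∑ q : P × Fin N.maxConst,
      ∑ n ∈ Finset.range (r.μ 0 (.tok q.1 (.minus q.2))), φ (r.key q n) {q} := by
  classical
  simp only [block, map_sum]
  rw [Finset.sum_comm]
  refine Finset.sum_congr rfl fun q _ => ?_
  rw [Finset.sum_comm]
  refine Finset.sum_congr rfl fun n hn => ?_
  rw [Finset.sum_eq_single (r.key q n)]
  · simp
  · intro κ _ h
    simp [h.symm]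
  · intro h
    exact absurd (r.key_mem_keys (Finset.mem_range.1 hn)) h

theorem minusWord_mem : r.minusWord ∈ permMinus (minusPart (r.μ 0)) := by
  classical
  refine ⟨fun b hb => ?_, fun p k => ?_⟩
  · obtain ⟨κ, hκ, rfl⟩ := List.mem_map.1 hb
    rw [Finset.mem_sort] at hκ
    obtain ⟨q, -, hq⟩ := Finset.mem_biUnion.1 hκ
    obtain ⟨n, hn, rfl⟩ := Finset.mem_image.1 hq
    intro h0
    have h1 := (Finset.sum_eq_zero_iff.1 ((Finset.sum_eq_zero_iff.1 h0) q (Finset.mem_univ _))) n hn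
    simp at h1
  · rw [minusWord, List.map_map, r.sum_sort_keys]
    have := r.sum_block fun _ => Multiset.countAddMonoidHom (p, k)
    simp only [Multiset.coe_countAddMonoidHom] at this
    refine Eq.trans ?_ ((Finset.sum_congr rfl fun κ _ => ?_ : _ = _).trans this).symm
    · rw [Finset.sum_eq_single (p, k)]
      · simp [minusPart]
      · intro q _ hq
        simp [hq.symm]
      · simp
    · simp

theorem mem_zenoWithin_of_mem_reg (wp : List (Multiset (P × Fin N.maxConst)))
    (hp : wp ∈ permPlus (plusPart (r.μ 0))) {M : TPN.Marking P}
    (hM : M ∈ (reg (r.μ 0) wp r.minusWord hp r.minusWord_mem).upMarkings) :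
    ∃ δ : ℝ, 0 < δ ∧ M ∈ N.zenoWithin (1 - δ) := by
  classical
  let g (b : Multiset (P × Fin N.maxConst)) (x : ℝ≥0) : TPN.Marking P :=
    b.map fun q => (q.1, ((q.2 : ℕ) : ℝ≥0) + x)
  obtain ⟨M₀, ⟨f, B, hf, hf01, hB, hBmax, hM₀⟩, hle⟩ :
    ∃ M₀, (∃ (f : Fin (wp ++ r.minusWord).length → ℝ≥0) (B : TPN.Marking P),
      StrictMono f ∧ (∀ i, 0 < f i ∧ f i < 1) ∧ (∀ q ∈ B, (N.maxConst : ℝ≥0) < q.2) ∧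
      B.map Prod.fst = ∑ p, Multiset.replicate (r.μ 0 (.tok p (.plus (Fin.last N.maxConst)))) p ∧
      M₀ = (∑ q : P × Fin (N.maxConst + 1), Multiset.replicate (r.μ 0 (.tok q.1 (.exact q.2))) q).map
        (fun q => (q.1, ((q.2 : ℕ) : ℝ≥0))) + ∑ i, g ((wp ++ r.minusWord).get i) (f i) + B) ∧
      M₀ ≤ M := hM
  have hsplit := sum_length_append wp r.minusWord f g
  let f₁ : Fin wp.length → ℝ≥0 := fun i => f ⟨i, by simp; omega⟩
  let f₂ : Fin r.minusWord.length → ℝ≥0 := fun i => f ⟨wp.length + i, by simp⟩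
  obtain ⟨F₀, hF₀, hF₀f, hF₀s⟩ := exists_strictAntiOn_of_sorted (r.keys.sort (· ≥ ·))
    (Finset.sortedGT_sort _).pairwise r.block f₂
    (fun i j h => hf (Fin.mk_lt_mk.2 (Nat.add_lt_add_left h _))) g
  -- The largest fractional part along w₊, or 0 if that word is empty. Keeping `F` above it puts
  -- F(⊤) above all initial fractional parts of tokens at k+ with k < max.
  let a := Finset.univ.sup f₁
  have ha : ∀ x : ℝ≥0, 0 < x → (∀ i, f₁ i < x) → a < x := fun x hx h =>
    (Finset.sup_lt_iff hx).2 fun i _ => h i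
  obtain ⟨F, hF, hF01, hFF₀⟩ := exists_strictAnti_extension
    (ha 1 one_pos fun i => (hf01 _).2) r.keys F₀ (by simpa using hF₀) (by
      intro κ hκ
      obtain ⟨i, hi⟩ := hF₀f κ (by simpa using hκ)
      rw [hi]
      refine ⟨ha _ (hf01 _).1 fun j => hf ?_, (hf01 _).2⟩
      rw [Fin.mk_lt_mk]
      omega)
  have hF0 : ∀ κ, 0 < F κ := fun κ => pos_of_gt (hF01 κ).1
  have hF1 : ∀ κ, F κ < 1 := fun κ => (hF01 κ).2
  refine ⟨F ⊤, hF0 ⊤, Simulates.mem_zenoWithin (r := r) hF hF0 hF1 ?_⟩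
  -- The symbol max+ is separate from the other k+: its tokens come from `B`, the others from the
  -- letters of w₊. On p(k-) the queue order follows the computation, with equal ages for equal
  -- keys.
  let Z : P → AgeSym N.maxConst → Multiset ℝ≥0 := fun p s => match s with
    | .exact k => .replicate (r.μ 0 (.tok p (.exact k))) ((k : ℕ) : ℝ≥0)
    | .plus k => k.lastCases ((B.filter fun q => q.1 = p).map Prod.snd) fun k =>
        ∑ i : Fin wp.length, .replicate ((wp.get i).count (p, k)) (((k : ℕ) : ℝ≥0) + f₁ i)
    | .minus k => ∑ n ∈ Finset.range (r.μ 0 (.tok p (.minus k))),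
        {((k : ℕ) : ℝ≥0) + F (r.key (p, k) n)}
  have hsum : ageTokens Z = M₀ := by
    have h1 : ∑ p, ∑ k, (Z p (.exact k)).map (Prod.mk p) =
        (∑ q : P × Fin (N.maxConst + 1), Multiset.replicate (r.μ 0 (.tok q.1 (.exact q.2))) q).map
          fun q => (q.1, ((q.2 : ℕ) : ℝ≥0)) := by
      rw [← Multiset.coe_mapAddMonoidHom, map_sum, Fintype.sum_prod_type]
      simp [Z]
    have h2 : ∑ p, ∑ k, (Z p (.plus k)).map (Prod.mk p) = ∑ i, g (wp.get i) (f₁ i) + B := by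
      have h (p : P) (k : Fin N.maxConst) : (Z p (.plus k.castSucc)).map (Prod.mk p) =
          ∑ i : Fin wp.length, .replicate ((wp.get i).count (p, k))
            (p, ((k : ℕ) : ℝ≥0) + f₁ i) := by
        simp only [Z, Fin.lastCases_castSucc]
        rw [← Multiset.coe_mapAddMonoidHom, map_sum]
        simp
      simp only [Fin.sum_univ_castSucc, h, Finset.sum_add_distrib]
      congr 1
      · rw [← Fintype.sum_prod_type', Finset.sum_comm]
        exact Finset.sum_congr rfl fun i _ => Multiset.sum_replicate_count _ _
      · simp only [Z, Fin.lastCases_last]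
        exact Multiset.sum_map_filter_fst B
    have h3 : ∑ p, ∑ k, (Z p (.minus k)).map (Prod.mk p) =
        ∑ i, g (r.minusWord.get i) (f₂ i) := by
      refine Eq.trans ?_ hF₀s.symm
      rw [r.sum_sort_keys]
      have h := r.sum_block fun κ =>
        Multiset.mapAddMonoidHom fun q => (q.1, ((q.2 : ℕ) : ℝ≥0) + F κ)
      simp only [Multiset.coe_mapAddMonoidHom, Multiset.map_singleton] at h
      refine Eq.trans ?_ (h.symm.trans (Finset.sum_congr rfl fun κ hκ => by rw [hFF₀ κ hκ]))
      rw [Fintype.sum_prod_type]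
      refine Finset.sum_congr rfl fun p _ => Finset.sum_congr rfl fun k _ => ?_
      simp only [Z]
      rw [← Multiset.coe_mapAddMonoidHom, map_sum]
      simp
    rw [hM₀, hsplit, ← h1]
    simp only [ageTokens, AgeSym.sum_eq, Finset.sum_add_distrib, h2, h3]
    abel
  refine ⟨Z, ⟨fun p s => ?_, fun p k x hx => ?_, fun p k x hx => ?_, fun p k => ?_⟩, hsum ▸ hle⟩
  · cases s with
    | exact k => simp [Z]
    | plus k =>
      induction k using Fin.lastCases with
      | last =>
        have := congrArg (Multiset.count p) hBmax
        simp [Multiset.count_map, Multiset.count_sum', Multiset.count_replicate] at this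
        simp [Z, ← this, eq_comm]
      | cast k =>
        have := hp.2 p k
        rw [← Fin.sum_univ_fun_getElem] at this
        simpa [Z, plusPart] using this.symm
    | minus k => simp [Z]
  · exact Multiset.eq_of_mem_replicate hx
  · induction k using Fin.lastCases with
    | last =>
      simp only [Z, Fin.lastCases_last] at hx
      obtain ⟨q, hq, rfl⟩ := Multiset.mem_map.1 hx
      exact ⟨hB q (Multiset.mem_filter.1 hq).1, fun h => absurd h (by simp)⟩
    | cast k =>
      simp only [Z, Fin.lastCases_castSucc] at hx
      obtain ⟨i, -, hi⟩ := Multiset.mem_sum.1 hx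
      obtain rfl := Multiset.eq_of_mem_replicate hi
      refine ⟨lt_add_of_pos_right _ (hf01 _).1, fun _ => ?_⟩
      rw [r.clock_zero, add_zero]
      simp only [Fin.val_castSucc]
      gcongr
      exact (Finset.le_sup (f := f₁) (Finset.mem_univ i)).trans_lt (hF01 ⊤).1
  · simp [Z, minusAge, r.served_zero, r.clock_zero]

end StdRun

theorem mainTheorem3 {P T : Type*} [Fintype P] [Fintype T] (N : TPN P T)
    (M' : SPlace P N.maxConst → ℕ) (hM' : M' ∈ N.infStd) :
    ∃ (wm : List (Multiset (P × Fin N.maxConst))) (hm : wm ∈ permMinus (minusPart M')),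
      ∀ (wp : List (Multiset (P × Fin N.maxConst))) (hp : wp ∈ permPlus (plusPart M')),
        (reg M' wp wm hp hm).upMarkings ⊆ (⋃ δ : {δ : ℝ // 0 < δ}, N.zenoWithin (1 - δ)) ∧
        (⋃ δ : {δ : ℝ // 0 < δ}, N.zenoWithin (1 - δ)) ⊆ N.zeno := by
  obtain ⟨r, rfl⟩ := TPN.exists_stdRun hM'
  refine ⟨r.minusWord, r.minusWord_mem, fun wp hp => ⟨fun M hM => ?_, fun M hM => ?_⟩⟩
  · obtain ⟨δ, hδ, h⟩ := r.mem_zenoWithin_of_mem_reg wp hp hM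
    exact Set.mem_iUnion.2 ⟨⟨δ, hδ⟩, h⟩
  · obtain ⟨δ, π, h0, hπ⟩ := Set.mem_iUnion.1 hM
    -- `δ` may exceed 1 in the union, but then no computation qualifies, as delays are nonnegative.
    have hnn : (0 : EReal) ≤ ((1 - (δ : ℝ) : ℝ) : EReal) :=
      (EReal.coe_ennreal_nonneg _).trans hπ
    exact Set.mem_iUnion.2 ⟨⟨1 - δ, EReal.coe_nonneg.1 hnn⟩, π, h0, hπ⟩
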